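/- Let $f:(-1,+\infty)\to\mathbb R$ be of class $C^2$ with $$\lim_{y\to-1^+}f(y)=+\infty,\qquad f(0)=0,\qquad f'(0)=-1,\qquad f'(y)<0<f''(y)\quad\text{for all }y>-1 .$$ Then $f$ is a decreasing bijection onto an interval $(f_{\min},+\infty)$ with $-\infty\le f_{\min}<0$; let $f^{-1}:(f_{\min},+\infty)\to(-1,+\infty)$ be its inverse. Let $\omega>0$ and $T=2\pi/\omega$. For every $A\ge 0$ the equation $$\frac{dy}{dt}=f(y)+A\sin\omega t$$ has exactly one $T$-periodic solution $Y=Y(\cdot,A):\mathbb R\to(-1,+\infty)$. Its minimum $Y_{\min}=Y_{\min}(A)=\inf_{t\in[0,T]}Y(t,A)$, which is attained, has the following properties. 1. For all $A\ge 0$: $\;-1<f^{-1}(A)\le Y_{\min}(A)\le 0$. 2. As $A\to0^+$, with $f$ and $\omega$ fixed: $\;Y_{\min}(A)=-\dfrac{A}{\sqrt{1+\omega^2}}+O(A^2)$. 3. $\displaystyle\lim_{A\to+\infty}Y_{\min}(A)=-1$ (the crack closes completely). -/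

import Mathlib

open Set Filter Topology Asymptotics

/-- The standing assumptions on the nonlinearity `f : (-1, ∞) → ℝ` of the model equation
`y' = f y + A sin (ω t)`. Only the values of `f` on `(-1, ∞)` are constrained. The image of `f` is
then automatically of the form `(f_min, ∞)` with `-∞ ≤ f_min < 0`. -/
structure IsContactLaw (f : ℝ → ℝ) : Prop where
  contDiffOn : ContDiffOn ℝ 2 f (Ioi (-1))
  tendsto_atTop : Tendsto f (𝓝[>] (-1)) atTop
  map_zero : f 0 = 0
  deriv_zero : deriv f 0 = -1
  deriv_neg : ∀ y : ℝ, -1 < y → deriv f y < 0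
  deriv_deriv_pos : ∀ y : ℝ, -1 < y → 0 < deriv (deriv f) y

/-- The inverse function of `f : (-1, ∞) → (f_min, ∞)`. -/
noncomputable def contactInv (f : ℝ → ℝ) : ℝ → ℝ :=
  Function.invFunOn f (Ioi (-1))

/-- `y` is a `T`-periodic solution, `T = 2 π / ω`, with values in `(-1, ∞)`, of
`y' = f y + A sin (ω t)`. -/
structure IsPeriodicSolution (f : ℝ → ℝ) (ω A : ℝ) (y : ℝ → ℝ) : Prop where
  neg_one_lt : ∀ t : ℝ, -1 < y t
  hasDerivAt : ∀ t : ℝ, HasDerivAt y (f (y t) + A * Real.sin (ω * t)) t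
  periodic : Function.Periodic y (2 * Real.pi / ω)

/-- The infimum of `y` over one period `[0, T]`, `T = 2 π / ω`. -/
noncomputable def periodInf (ω : ℝ) (y : ℝ → ℝ) : ℝ :=
  sInf (y '' Icc 0 (2 * Real.pi / ω))

/-! ### Periodic functions and differential inequalities -/

/-! Existence is a one-dimensional fixed point argument for the time-`T` map. With `m = contactInv f
A`, the constant `m` is a lower barrier and `A / ω * (1 - cos (ω t))`, which returns to `0` at time
`T`, is an upper one. So the time-`T` map sends `[m, 0]` into itself once `f` is truncated, and the
barriers make the truncation invisible. Uniqueness holds because monotonicity of `f` contracts the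
distance of two solutions.

The estimates come from critical points of periodic functions. At a minimum of `y`, `f y = -A sin (ω
t) ≤ A`. At a maximum of `z = y + A / ω * cos (ω t)`, `z' = f y` vanishes, so `y = 0`. For small
`A`, the difference `w` from the linear response solves `w' = -w + (f y + y)`. At its extrema `w = f
y + y`, which lies between `0` and `O(A²)` (`periodInf_mem_Icc`).

For large `A`, suppose `y ≥ b > -1`. Then `z' ≤ f b` bounds `z` below, and the forcing lifts `y`
above `1` on most of the period. There `z' ≤ f 1 < 0`, so `z` has a net loss over a period, which is
impossible (`periodInf_lt`). -/

/-- A continuous periodic function attains its minimum, at a point of `[0, T]`. -/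
lemma Function.Periodic.exists_forall_ge {g : ℝ → ℝ} {T : ℝ} (hg : Function.Periodic g T)
    (hT : 0 < T) (hc : Continuous g) : ∃ s ∈ Icc 0 T, ∀ t, g s ≤ g t := by
  obtain ⟨s, hs, hmin⟩ := isCompact_Icc.exists_isMinOn (nonempty_Icc.2 hT.le) hc.continuousOn
  refine ⟨s, hs, fun t => ?_⟩
  obtain ⟨t', ht', h⟩ := hg.exists_mem_Ico₀ hT t
  rw [h]
  exact hmin (Ico_subset_Icc_self ht')

/-- A differentiable periodic function attains its minimum, and its derivative vanishes there. -/
lemma Function.Periodic.exists_forall_ge_deriv_eq_zero {g g' : ℝ → ℝ} {T : ℝ}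
    (hg : Function.Periodic g T) (hT : 0 < T) (hd : ∀ t, HasDerivAt g (g' t) t) :
    ∃ s ∈ Icc 0 T, (∀ t, g s ≤ g t) ∧ g' s = 0 := by
  obtain ⟨s, hs, h⟩ := hg.exists_forall_ge hT
    (continuous_iff_continuousAt.2 fun t => (hd t).continuousAt)
  exact ⟨s, hs, h, IsLocalMin.hasDerivAt_eq_zero (Eventually.of_forall h) (hd s)⟩

/-- A differentiable periodic function attains its maximum, and its derivative vanishes there. -/
lemma Function.Periodic.exists_forall_le_deriv_eq_zero {g g' : ℝ → ℝ} {T : ℝ}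
    (hg : Function.Periodic g T) (hT : 0 < T) (hd : ∀ t, HasDerivAt g (g' t) t) :
    ∃ s ∈ Icc 0 T, (∀ t, g t ≤ g s) ∧ g' s = 0 := by
  have hp : Function.Periodic (fun t => -g t) T := fun t => by simp only [hg t]
  obtain ⟨s, hs, h, h0⟩ := hp.exists_forall_ge_deriv_eq_zero hT fun t => (hd t).neg
  exact ⟨s, hs, fun t => neg_le_neg_iff.1 (h t), neg_eq_zero.1 h0⟩

/-- A periodic antitone function is constant. -/
lemma Function.Periodic.eq_of_antitone {g : ℝ → ℝ} {T : ℝ} (hg : Function.Periodic g T)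
    (hT : 0 < T) (ha : Antitone g) (s t : ℝ) : g s = g t := by
  have key : ∀ s t : ℝ, g s ≤ g t := fun s t => by
    obtain ⟨n, hn⟩ := exists_nat_ge ((t - s) / T)
    rw [div_le_iff₀ hT] at hn
    have h := hg.nat_mul n s
    rw [← h]
    exact ha (by linarith)
  exact le_antisymm (key s t) (key t s)

/-- A function that is nonpositive at the left end point and does not increase where it is
positive stays nonpositive. -/
lemma nonpos_of_deriv_nonpos_of_pos {u u' : ℝ → ℝ} {a b : ℝ}
    (hu : ∀ t ∈ Icc a b, HasDerivWithinAt u (u' t) (Icc a b) t) (ha : u a ≤ 0)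
    (h : ∀ t ∈ Icc a b, 0 < u t → u' t ≤ 0) : ∀ t ∈ Icc a b, u t ≤ 0 := by
  intro t ht
  -- The barrier is positive with slope `ε > 0`, so at a contact point `u > 0` and `u' ≤ 0 < ε`;
  -- then `ε` is made small.
  have key : ∀ ε : ℝ, 0 < ε → u t ≤ ε * (1 + (t - a)) := fun ε hε => by
    refine image_le_of_deriv_right_lt_deriv_boundary (f := u) (f' := u') (a := a) (b := b)
      (B := fun s => ε * (1 + (s - a))) (B' := fun _ => ε)
      (fun s hs => (hu s hs).continuousWithinAt) (fun s hs => ?_) ?_ (fun s => ?_) ?_ ht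
    · exact (hu s (Ico_subset_Icc_self hs)).mono_of_mem_nhdsWithin (Icc_mem_nhdsGE_of_mem hs)
    · simp only [sub_self, add_zero, mul_one]; linarith
    · simpa using (((hasDerivAt_id s).sub_const a).const_add 1).const_mul ε
    · intro s hs hus
      have : 0 < u s := by
        rw [hus]
        have := hs.1
        exact mul_pos hε (by linarith)
      linarith [h s (Ico_subset_Icc_self hs) this]
  by_contra! hpos
  have h1 : 0 < 1 + (t - a) := by linarith [ht.1]
  have := key (u t / (2 * (1 + (t - a)))) (by positivity)
  have h2 : u t / (2 * (1 + (t - a))) * (1 + (t - a)) = u t / 2 := by field_simp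
  linarith

/-! ### Periodic solutions from the time-`T` map -/

/-- A solution on `[0, T]` with equal end point values of an equation that is `T`-periodic in time
extends to a `T`-periodic solution on the line. -/
lemma exists_periodic_extension {v : ℝ → ℝ → ℝ} {T : ℝ} (hT : 0 < T)
    (hv : ∀ t x, v (t + T) x = v t x) {y : ℝ → ℝ}
    (hy : ∀ t ∈ Icc 0 T, HasDerivWithinAt y (v t (y t)) (Icc 0 T) t) (h0 : y 0 = y T) :
    ∃ Y : ℝ → ℝ, Function.Periodic Y T ∧ EqOn Y y (Icc 0 T) ∧
      ∀ t, HasDerivAt Y (v t (Y t)) t := by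
  set Y : ℝ → ℝ := fun t => y (toIcoMod hT 0 t) with hY
  have hper : Function.Periodic Y T := fun t => by simp only [hY, toIcoMod_add_right]
  have heq : EqOn Y y (Icc 0 T) := by
    intro t ht
    rcases ht.2.eq_or_lt with rfl | h
    · have : Y (0 + t) = Y 0 := hper 0
      rw [zero_add] at this
      rw [this, ← h0]
      simp [hY]
    · simp only [hY]
      rw [(toIcoMod_eq_self hT).2 (by simpa using ⟨ht.1, h⟩)]
  have hright : ∀ t ∈ Icc 0 T, HasDerivWithinAt Y (v t (Y t)) (Icc 0 T) t := fun t ht => by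
    rw [heq ht]
    exact (hy t ht).congr heq (heq ht)
  have hIoo : ∀ t ∈ Ico 0 T, HasDerivAt Y (v t (Y t)) t := by
    intro t ht
    rcases ht.1.eq_or_lt with rfl | h
    · have h1 := hright 0 ⟨le_rfl, hT.le⟩
      -- The left derivative at `0` is the one at `T`, translated by a period.
      have h2 : HasDerivWithinAt Y (v 0 (Y 0)) (Icc (-T) 0) 0 := by
        have h3 := hright T ⟨hT.le, le_rfl⟩
        have e : v T (Y T) = v 0 (Y 0) := by
          have a := hv 0 (Y T); have b := hper 0
          rw [zero_add] at a b
          rw [a, b]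
        rw [e] at h3
        have h4 : HasDerivWithinAt (fun s => s + T) 1 (Icc (-T) 0) (0 : ℝ) :=
          ((hasDerivAt_id (0 : ℝ)).add_const T).hasDerivWithinAt
        have h5 := HasDerivWithinAt.comp (h₂ := Y) (h := fun s => s + T) (s' := Icc 0 T) (0 : ℝ)
          (by simpa using h3) h4 (fun s hs => ⟨by linarith [hs.1], by linarith [hs.2]⟩)
        rw [mul_one] at h5
        refine h5.congr (fun s _ => (hper s).symm) (hper 0).symm
      refine (h2.union h1).hasDerivAt ?_
      rw [Icc_union_Icc_eq_Icc (by linarith) hT.le]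
      exact Icc_mem_nhds (by linarith) hT
    · exact (hright t ⟨ht.1, ht.2.le⟩).hasDerivAt (Icc_mem_nhds h ht.2)
  refine ⟨Y, hper, heq, fun t => ?_⟩
  have hvn : Function.Periodic v T := fun s => funext (hv s)
  have hz := hvn.sub_zsmul_eq (x := t) (toIcoDiv hT 0 t)
  have hz' := hper.sub_zsmul_eq (x := t) (toIcoDiv hT 0 t)
  have hd := hIoo (t - toIcoDiv hT 0 t • T) (by
    have := toIcoMod_mem_Ico hT 0 t
    rw [zero_add] at this
    exact this)
  rw [hz, hz'] at hd
  refine (hd.comp_sub_const t (toIcoDiv hT 0 t • T)).congr_of_eventuallyEq ?_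
  exact Eventually.of_forall fun s => (hper.sub_zsmul_eq (x := s) _).symm

/-- Let `v` be bounded and Lipschitz in space. If trajectories on `[0, T]` that start at `a` or `b`
do not leave `[a, b]` through that end point, then some trajectory closes up. -/
lemma exists_solution_eq_endpoints {v : ℝ → ℝ → ℝ} {T a b : ℝ} {K : NNReal} {C : ℝ} (hT : 0 ≤ T)
    (hab : a ≤ b) (hlip : ∀ t, LipschitzWith K (v t)) (hcont : ∀ x, Continuous fun t => v t x)
    (hbdd : ∀ t x, |v t x| ≤ C)
    (ha : ∀ y : ℝ → ℝ, y 0 = a → (∀ t ∈ Icc 0 T, HasDerivWithinAt y (v t (y t)) (Icc 0 T) t) →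
      a ≤ y T)
    (hb : ∀ y : ℝ → ℝ, y 0 = b → (∀ t ∈ Icc 0 T, HasDerivWithinAt y (v t (y t)) (Icc 0 T) t) →
      y T ≤ b) :
    ∃ y : ℝ → ℝ, y 0 ∈ Icc a b ∧ y 0 = y T ∧
      ∀ t ∈ Icc 0 T, HasDerivWithinAt y (v t (y t)) (Icc 0 T) t := by
  have hC : 0 ≤ C := (abs_nonneg _).trans (hbdd 0 0)
  -- The ball of radius `b - a` about `a` covers all starting points in `[a, b]`; the extra `C * T`
  -- is the farthest that speed `C` can carry them.
  have hPL : IsPicardLindelof v (tmin := 0) (tmax := T) ⟨0, le_rfl, hT⟩ a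
      (⟨C * T + (b - a), by have := mul_nonneg hC hT; linarith⟩ : NNReal)
      (⟨b - a, by linarith⟩ : NNReal) (⟨C, hC⟩ : NNReal) K :=
    { lipschitzOnWith := fun t _ => (hlip t).lipschitzOnWith
      continuousOn := fun x _ => (hcont x).continuousOn
      norm_le := fun t _ x _ => hbdd t x
      mul_max_le := by
        simp only [sub_zero, sub_self, max_eq_left hT]
        change C * T ≤ C * T + (b - a) - (b - a)
        linarith }
  obtain ⟨α, hα, L', hL'⟩ :=
    hPL.exists_forall_mem_closedBall_eq_hasDerivWithinAt_lipschitzOnWith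
  have hsub : ∀ x ∈ Icc a b, x ∈ Metric.closedBall a (b - a) := fun x hx => by
    rw [Metric.mem_closedBall, Real.dist_eq, abs_le]
    constructor <;> linarith [hx.1, hx.2]
  have hP : ContinuousOn (fun x => α x T - x) (Icc a b) :=
    ((hL' T ⟨hT, le_rfl⟩).continuousOn.mono hsub).sub continuousOn_id
  have hA := hα a (hsub a ⟨le_rfl, hab⟩)
  have hB := hα b (hsub b ⟨hab, le_rfl⟩)
  obtain ⟨x, hx, hx0⟩ := intermediate_value_Icc' hab hP
    (show (0 : ℝ) ∈ Icc (α b T - b) (α a T - a) from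
      ⟨by linarith [hb _ hB.1 hB.2], by linarith [ha _ hA.1 hA.2]⟩)
  have hX := hα x (hsub x hx)
  have hX0 : α x 0 = x := hX.1
  refine ⟨α x, by rw [hX0]; exact hx, ?_, hX.2⟩
  have : α x T - x = 0 := hx0
  rw [hX0]
  linarith

/-! ### Elementary properties of contact laws -/

namespace IsContactLaw

variable {f : ℝ → ℝ}

lemma differentiableAt (hf : IsContactLaw f) {y : ℝ} (hy : -1 < y) : DifferentiableAt ℝ f y :=
  (hf.contDiffOn.contDiffAt (Ioi_mem_nhds hy)).differentiableAt (by norm_num)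

lemma continuousOn (hf : IsContactLaw f) : ContinuousOn f (Ioi (-1)) :=
  hf.contDiffOn.continuousOn

lemma strictAntiOn (hf : IsContactLaw f) : StrictAntiOn f (Ioi (-1)) :=
  strictAntiOn_of_deriv_neg (convex_Ioi _) hf.continuousOn fun y hy => by
    rw [interior_Ioi] at hy
    exact hf.deriv_neg y hy

/-- `deriv` takes the value `0` at points of non-differentiability, so a positive second derivative
rules these out. -/
lemma differentiableAt_deriv (hf : IsContactLaw f) {y : ℝ} (hy : -1 < y) :
    DifferentiableAt ℝ (deriv f) y :=
  differentiableAt_of_deriv_ne_zero (hf.deriv_deriv_pos y hy).ne'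

lemma convexOn (hf : IsContactLaw f) : ConvexOn ℝ (Ioi (-1)) f := by
  refine convexOn_of_deriv2_nonneg (convex_Ioi _) hf.continuousOn ?_ ?_ ?_ <;>
    rw [interior_Ioi]
  · exact fun y hy => (hf.differentiableAt hy).differentiableWithinAt
  · exact fun y hy => (hf.differentiableAt_deriv hy).differentiableWithinAt
  · exact fun y hy => (hf.deriv_deriv_pos y hy).le

/-- A contact law lies above its tangent line at the origin. -/
lemma neg_le (hf : IsContactLaw f) {y : ℝ} (hy : -1 < y) : -y ≤ f y := by
  have h0 : (0 : ℝ) ∈ Ioi (-1 : ℝ) := by norm_num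
  rcases lt_trichotomy y 0 with h | rfl | h
  · have := hf.convexOn.slope_le_deriv hy h0 h (hf.differentiableAt h0)
    rw [hf.deriv_zero, slope_def_field, hf.map_zero, div_le_iff₀ (by linarith)] at this
    linarith
  · simp [hf.map_zero]
  · have := hf.convexOn.deriv_le_slope h0 hy h (hf.differentiableAt h0)
    rw [hf.deriv_zero, slope_def_field, hf.map_zero, le_div_iff₀ (by linarith)] at this
    linarith

/-- The second order bound for a contact law near the origin. -/
lemma exists_add_self_le (hf : IsContactLaw f) :
    ∃ K r : ℝ, 0 ≤ K ∧ 0 < r ∧ ∀ y : ℝ, |y| ≤ r → f y + y ≤ K * y ^ 2 := by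
  have h0 : (-1 : ℝ) < 0 := by norm_num
  -- Differentiability of `f'` at `0` gives `f' + 1 = O(|x|)`; the mean value inequality then gains
  -- one more power.
  obtain ⟨K, hK, hO⟩ := (hf.differentiableAt_deriv h0).isBigO_sub.exists_pos
  rw [isBigOWith_iff] at hO
  obtain ⟨r, hr, hball⟩ := Metric.eventually_nhds_iff_ball.1
    (hO.and (Ioi_mem_nhds h0))
  refine ⟨K, r / 2, hK.le, by positivity, fun y hy => ?_⟩
  have hmem : ∀ x ∈ Icc (-|y|) |y|, x ∈ Metric.ball (0 : ℝ) r := fun x hx => by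
    rw [Metric.mem_ball, dist_zero_right, Real.norm_eq_abs]
    linarith [abs_le.2 hx]
  have hd : ∀ x ∈ Icc (-|y|) |y|, HasDerivWithinAt (fun x => f x + x) (deriv f x + 1)
      (Icc (-|y|) |y|) x := fun x hx =>
    ((hf.differentiableAt (hball x (hmem x hx)).2).hasDerivAt.add (hasDerivAt_id x)).hasDerivWithinAt
  have hb : ∀ x ∈ Icc (-|y|) |y|, ‖deriv f x + 1‖ ≤ K * |y| := fun x hx => by
    have := (hball x (hmem x hx)).1
    rw [hf.deriv_zero, sub_neg_eq_add, sub_zero] at this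
    refine this.trans ?_
    gcongr
    exact abs_le.2 hx
  have := (convex_Icc (-|y|) |y|).norm_image_sub_le_of_norm_hasDerivWithin_le hd hb
    (x := 0) (y := y) ⟨by simp, by simp⟩ (abs_le.1 le_rfl)
  simp only [hf.map_zero, add_zero, sub_zero, Real.norm_eq_abs] at this
  calc f y + y ≤ K * |y| * |y| := (le_abs_self _).trans this
    _ = K * y ^ 2 := by rw [mul_assoc, abs_mul_abs_self, sq]

/-- Every nonnegative value is attained by a contact law. -/
lemma exists_eq (hf : IsContactLaw f) {A : ℝ} (hA : 0 ≤ A) : ∃ y ∈ Ioi (-1 : ℝ), f y = A := by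
  obtain ⟨x, ⟨hx, hx0⟩⟩ := ((hf.tendsto_atTop.eventually_ge_atTop A).and
    (Ioo_mem_nhdsGT (show (-1 : ℝ) < 0 by norm_num))).exists
  obtain ⟨y, hy, h⟩ := intermediate_value_Icc' hx0.2.le
    (hf.continuousOn.mono fun z hz => lt_of_lt_of_le hx0.1 hz.1)
    (show A ∈ Icc (f 0) (f x) from ⟨by rw [hf.map_zero]; exact hA, hx⟩)
  exact ⟨y, lt_of_lt_of_le hx0.1 hy.1, h⟩

lemma map_contactInv (hf : IsContactLaw f) {A : ℝ} (hA : 0 ≤ A) : f (contactInv f A) = A :=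
  Function.invFunOn_eq (hf.exists_eq hA)

lemma neg_one_lt_contactInv (hf : IsContactLaw f) {A : ℝ} (hA : 0 ≤ A) : -1 < contactInv f A :=
  Function.invFunOn_mem (hf.exists_eq hA)

lemma contactInv_nonpos (hf : IsContactLaw f) {A : ℝ} (hA : 0 ≤ A) : contactInv f A ≤ 0 := by
  rw [← hf.strictAntiOn.le_iff_ge (show (-1 : ℝ) < 0 by norm_num) (hf.neg_one_lt_contactInv hA),
    hf.map_contactInv hA, hf.map_zero]
  exact hA

lemma nonpos (hf : IsContactLaw f) {y : ℝ} (hy : 0 ≤ y) : f y ≤ 0 := by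
  rw [← hf.map_zero]
  exact hf.strictAntiOn.antitoneOn (show (-1 : ℝ) < 0 by norm_num)
    (show (-1 : ℝ) < y by linarith) hy

/-! ### Existence of a periodic solution -/

lemma exists_isPeriodicSolution (hf : IsContactLaw f) {ω A : ℝ} (hω : 0 < ω) (hA : 0 ≤ A) :
    ∃ y, IsPeriodicSolution f ω A y := by
  set T := 2 * Real.pi / ω with hTdef
  have hT : 0 < T := by positivity
  have hωT : ω * T = 2 * Real.pi := by rw [hTdef]; field_simp
  set m := contactInv f A with hm
  have hm1 : -1 < m := hf.neg_one_lt_contactInv hA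
  have hm0 : m ≤ 0 := hf.contactInv_nonpos hA
  have hfm : f m = A := hf.map_contactInv hA
  have hAω : 0 ≤ A / ω := by positivity
  -- The maximum of the upper barrier `A / ω * (1 - cos (ω t))`.
  set M := 2 * (A / ω) with hM
  have hmM : m ≤ M := by linarith
  set c : ℝ → ℝ := fun x => projIcc m M hmM x with hc
  have hcmem : ∀ x, c x ∈ Icc m M := fun x => (projIcc m M hmM x).2
  have hcself : ∀ x ∈ Icc m M, c x = x := fun x hx => by simp only [hc, projIcc_of_mem hmM hx]
  have hsub : Icc m M ⊆ Ioi (-1) := fun x hx => lt_of_lt_of_le hm1 hx.1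
  obtain ⟨K, hK⟩ := (hf.contDiffOn.mono hsub).exists_lipschitzOnWith (by norm_num)
    (convex_Icc m M) isCompact_Icc
  have hFlip : LipschitzWith K fun x => f (c x) := by
    have h1 : LipschitzWith 1 c := LipschitzWith.subtype_val _ |>.comp (LipschitzWith.projIcc hmM)
      |>.weaken (by norm_num)
    have := hK.comp h1.lipschitzOnWith (fun x _ => hcmem x) (s := univ)
    rw [mul_one] at this
    exact lipschitzOnWith_univ.1 this
  have hcanti : ∀ x, f (c x) ≤ A := fun x => by
    rw [← hfm]
    exact hf.strictAntiOn.antitoneOn hm1 (hsub (hcmem x)) (hcmem x).1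
  have hcge : ∀ x, f M ≤ f (c x) := fun x =>
    hf.strictAntiOn.antitoneOn (hsub (hcmem x)) (hsub ⟨hmM, le_rfl⟩) (hcmem x).2
  set v : ℝ → ℝ → ℝ := fun t x => f (c x) + A * Real.sin (ω * t) with hv
  -- Below `m` the truncated field equals `A + A sin (ω t) ≥ 0`.
  have hlower : ∀ y : ℝ → ℝ, m ≤ y 0 →
      (∀ t ∈ Icc 0 T, HasDerivWithinAt y (v t (y t)) (Icc 0 T) t) → ∀ t ∈ Icc 0 T, m ≤ y t := by
    intro y h0 hy t ht
    refine sub_nonpos.1 (nonpos_of_deriv_nonpos_of_pos (u := fun t => m - y t)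
      (fun s hs => (hy s hs).const_sub m) (sub_nonpos.2 h0) (fun s hs hpos => ?_) t ht)
    have : c (y s) = m := by simp only [hc, projIcc_of_le_left hmM (by linarith : y s ≤ m)]
    simp only [hv, this, hfm]
    nlinarith [Real.neg_one_le_sin (ω * s)]
  -- The barrier is nonnegative with derivative `A sin (ω t)`; above it `f (c y) ≤ 0`, so `y` grows
  -- no faster.
  have hupper : ∀ y : ℝ → ℝ, y 0 ≤ 0 →
      (∀ t ∈ Icc 0 T, HasDerivWithinAt y (v t (y t)) (Icc 0 T) t) →
      ∀ t ∈ Icc 0 T, y t ≤ A / ω * (1 - Real.cos (ω * t)) := by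
    intro y h0 hy t ht
    have hd : ∀ s, HasDerivAt (fun t => A / ω * (1 - Real.cos (ω * t))) (A * Real.sin (ω * s)) s :=
      fun s => by
        convert! ((((hasDerivAt_id s).const_mul ω).cos).const_sub 1).const_mul (A / ω) using 1
        simp only [id]
        field_simp
    refine sub_nonpos.1 (nonpos_of_deriv_nonpos_of_pos
      (u := fun t => y t - A / ω * (1 - Real.cos (ω * t)))
      (fun s hs => (hy s hs).sub (hd s).hasDerivWithinAt) (by simpa using h0)
      (fun s hs hpos => ?_) t ht)
    have h1 : 0 ≤ A / ω * (1 - Real.cos (ω * s)) :=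
      mul_nonneg hAω (by linarith [Real.cos_le_one (ω * s)])
    have h2 : 0 ≤ c (y s) := by
      simp only [hc, coe_projIcc]
      exact le_max_of_le_right (le_min (by linarith) (by linarith))
    have := hf.nonpos h2
    simp only [hv]
    linarith
  obtain ⟨y, hy0, hyT, hy⟩ := exists_solution_eq_endpoints (v := v) (K := K)
    (C := |A| + |f M| + |A|) hT.le hm0
    (fun t => by simpa using hFlip.add (LipschitzWith.const (A * Real.sin (ω * t))))
    (fun x => by simp only [hv]; fun_prop)
    (fun t x => by
      refine (abs_add_le _ _).trans (add_le_add ?_ ?_)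
      · exact (abs_le_max_abs_abs (hcge x) (hcanti x)).trans
          (max_le (by linarith [abs_nonneg A]) (by linarith [abs_nonneg (f M)]))
      · rw [abs_mul]
        exact mul_le_of_le_one_right (abs_nonneg _) (Real.abs_sin_le_one _))
    (fun y h0 hy => hlower y h0.ge hy T ⟨hT.le, le_rfl⟩)
    (fun y h0 hy => by
      have := hupper y h0.le hy T ⟨hT.le, le_rfl⟩
      rwa [hωT, Real.cos_two_pi, sub_self, mul_zero] at this)
  obtain ⟨Y, hper, hYy, hY⟩ := exists_periodic_extension hT (v := v)
    (fun t x => by simp only [hv, mul_add, hωT, Real.sin_add_two_pi]) hy hyT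
  have hYmem : ∀ t, Y t ∈ Icc m M := fun t => by
    obtain ⟨s, hs, h⟩ := hper.exists_mem_Ico₀ hT t
    have hs' := Ico_subset_Icc_self hs
    rw [h, hYy hs']
    refine ⟨hlower y hy0.1 hy s hs', (hupper y hy0.2 hy s hs').trans ?_⟩
    rw [hM]
    nlinarith [Real.neg_one_le_cos (ω * s)]
  refine ⟨Y, fun t => hsub (hYmem t), fun t => ?_, hper⟩
  have := hY t
  simp only [hv, hcself _ (hYmem t)] at this
  exact this

end IsContactLaw

/-! ### Uniqueness and a priori bounds -/

namespace IsPeriodicSolution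

variable {f : ℝ → ℝ} {ω A : ℝ} {y : ℝ → ℝ}

/-- Since `f` is strictly decreasing, `(y - z) ^ 2` strictly decreases wherever `y ≠ z`, whereas a
periodic antitone function is constant. -/
lemma unique (hf : IsContactLaw f) (hω : 0 < ω) {z : ℝ → ℝ} (hy : IsPeriodicSolution f ω A y)
    (hz : IsPeriodicSolution f ω A z) : y = z := by
  have hT : 0 < 2 * Real.pi / ω := by positivity
  have hd : ∀ t, HasDerivAt (fun t => (y t - z t) ^ 2)
      (2 * ((y t - z t) * (f (y t) - f (z t)))) t := fun t => by
    convert! ((hy.hasDerivAt t).sub (hz.hasDerivAt t)).pow 2 using 1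
    simp only [Pi.sub_apply]
    ring
  have hp : Function.Periodic (fun t => (y t - z t) ^ 2) (2 * Real.pi / ω) := fun t => by
    simp only [hy.periodic t, hz.periodic t]
  have hneg : ∀ t, y t ≠ z t → (y t - z t) * (f (y t) - f (z t)) < 0 := fun t ht => by
    rcases lt_or_gt_of_ne ht with h | h
    · have := hf.strictAntiOn (hy.neg_one_lt t) (hz.neg_one_lt t) h
      exact mul_neg_of_neg_of_pos (by linarith) (by linarith)
    · have := hf.strictAntiOn (hz.neg_one_lt t) (hy.neg_one_lt t) h
      exact mul_neg_of_pos_of_neg (by linarith) (by linarith)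
  have hanti : Antitone fun t => (y t - z t) ^ 2 := by
    refine antitone_of_hasDerivAt_nonpos hd fun t => ?_
    by_cases h : y t = z t
    · simp [h]
    · have := hneg t h
      simp only [Pi.zero_apply]
      linarith
  funext t
  by_contra h
  have hconst : (fun t => (y t - z t) ^ 2) = fun _ => (y 0 - z 0) ^ 2 :=
    funext fun s => hp.eq_of_antitone hT hanti s 0
  have h1 := hd t
  rw [hconst] at h1
  have := h1.unique (hasDerivAt_const t _)
  linarith [hneg t h]

/-- The infimum over a period is the minimum over the line, attained in the period. -/
lemma exists_eq_periodInf (hω : 0 < ω) (hy : IsPeriodicSolution f ω A y) :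
    ∃ s ∈ Icc 0 (2 * Real.pi / ω), y s = periodInf ω y ∧ (∀ t, y s ≤ y t) ∧
      f (y s) + A * Real.sin (ω * s) = 0 := by
  obtain ⟨s, hs, hmin, h0⟩ :=
    hy.periodic.exists_forall_ge_deriv_eq_zero (by positivity) hy.hasDerivAt
  have h : IsLeast (y '' Icc 0 (2 * Real.pi / ω)) (y s) :=
    ⟨mem_image_of_mem y hs, by rintro _ ⟨t, -, rfl⟩; exact hmin t⟩
  exact ⟨s, hs, h.csInf_eq.symm, hmin, h0⟩

/-- Removing the oscillation of the forcing. -/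
lemma hasDerivAt_add_cos (hω : 0 < ω) (hy : IsPeriodicSolution f ω A y) (t : ℝ) :
    HasDerivAt (fun t => y t + A / ω * Real.cos (ω * t)) (f (y t)) t := by
  convert! (hy.hasDerivAt t).add ((((hasDerivAt_id t).const_mul ω).cos).const_mul (A / ω)) using 1
  simp only [id]
  field_simp
  ring

lemma periodic_add_cos (hω : 0 < ω) (hy : IsPeriodicSolution f ω A y) :
    Function.Periodic (fun t => y t + A / ω * Real.cos (ω * t)) (2 * Real.pi / ω) := fun t => by
  have : ω * (2 * Real.pi / ω) = 2 * Real.pi := by field_simp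
  simp only [hy.periodic t, mul_add, this, Real.cos_add_two_pi]

lemma contactInv_le (hf : IsContactLaw f) (hω : 0 < ω) (hA : 0 ≤ A)
    (hy : IsPeriodicSolution f ω A y) : contactInv f A ≤ periodInf ω y := by
  obtain ⟨s, -, hs, -, h0⟩ := hy.exists_eq_periodInf hω
  rw [← hs, ← hf.strictAntiOn.le_iff_ge (hy.neg_one_lt s) (hf.neg_one_lt_contactInv hA),
    hf.map_contactInv hA]
  nlinarith [Real.neg_one_le_sin (ω * s)]

lemma exists_apply_eq_zero (hf : IsContactLaw f) (hω : 0 < ω)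
    (hy : IsPeriodicSolution f ω A y) :
    ∃ s, y s = 0 ∧ ∀ t, y t + A / ω * Real.cos (ω * t) ≤ y s + A / ω * Real.cos (ω * s) := by
  obtain ⟨s, -, hmax, h0⟩ := (hy.periodic_add_cos hω).exists_forall_le_deriv_eq_zero
    (by positivity) (hy.hasDerivAt_add_cos hω)
  refine ⟨s, ?_, hmax⟩
  rw [← hf.map_zero] at h0
  exact hf.strictAntiOn.injOn (hy.neg_one_lt s) (show (-1 : ℝ) < 0 by norm_num) h0

lemma periodInf_nonpos (hf : IsContactLaw f) (hω : 0 < ω) (hy : IsPeriodicSolution f ω A y) :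
    periodInf ω y ≤ 0 := by
  obtain ⟨s, -, hs, hmin, -⟩ := hy.exists_eq_periodInf hω
  obtain ⟨t, ht, -⟩ := hy.exists_apply_eq_zero hf hω
  rw [← hs, ← ht]
  exact hmin t

/-- Linearity in `A` is what makes the remainder `f y + y` quadratic in `A`. The lower bound uses
the tangent line at `0`, the upper one the maximum of `y + A / ω * cos (ω t)`, where `y = 0`. -/
lemma abs_le (hf : IsContactLaw f) (hω : 0 < ω) (hA : 0 ≤ A) (hy : IsPeriodicSolution f ω A y)
    (t : ℝ) : |y t| ≤ (1 + 2 / ω) * A := by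
  have hAω : 0 ≤ A / ω := by positivity
  have e : (1 + 2 / ω) * A = A + 2 * (A / ω) := by ring
  rw [e, _root_.abs_le]
  constructor
  · obtain ⟨s, -, hs, hmin, -⟩ := hy.exists_eq_periodInf hω
    have h1 := hy.contactInv_le hf hω hA
    have h2 := hf.neg_le (hf.neg_one_lt_contactInv hA)
    rw [hf.map_contactInv hA] at h2
    linarith [hmin t]
  · obtain ⟨s, hs, hmax⟩ := hy.exists_apply_eq_zero hf hω
    have h1 := hmax t
    rw [hs] at h1
    nlinarith [Real.neg_one_le_cos (ω * t), Real.cos_le_one (ω * s)]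

end IsPeriodicSolution

/-! ### The linearised equation -/

/-- The periodic solution of the linearised equation. -/
noncomputable def linearResponse (ω A t : ℝ) : ℝ :=
  A / (1 + ω ^ 2) * (Real.sin (ω * t) - ω * Real.cos (ω * t))

lemma hasDerivAt_linearResponse (ω A t : ℝ) :
    HasDerivAt (linearResponse ω A) (-linearResponse ω A t + A * Real.sin (ω * t)) t := by
  have h : 1 + ω ^ 2 ≠ 0 := by positivity
  have hl := (hasDerivAt_id t).const_mul ω
  convert! (hl.sin.sub (hl.cos.const_mul ω)).const_mul (A / (1 + ω ^ 2)) using 1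
  simp only [linearResponse, id]
  field_simp
  ring

lemma linearResponse_periodic {ω : ℝ} (hω : 0 < ω) (A : ℝ) :
    Function.Periodic (linearResponse ω A) (2 * Real.pi / ω) := fun t => by
  have : ω * (2 * Real.pi / ω) = 2 * Real.pi := by field_simp
  simp only [linearResponse, mul_add, this, Real.cos_add_two_pi, Real.sin_add_two_pi]

lemma neg_div_sqrt_le_linearResponse {ω A : ℝ} (hA : 0 ≤ A) (t : ℝ) :
    -(A / √(1 + ω ^ 2)) ≤ linearResponse ω A t := by
  have hq : 0 < √(1 + ω ^ 2) := by positivity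
  have hqq : √(1 + ω ^ 2) ^ 2 = 1 + ω ^ 2 := Real.sq_sqrt (by positivity)
  have key : -√(1 + ω ^ 2) ≤ Real.sin (ω * t) - ω * Real.cos (ω * t) := by
    refine (abs_le.1 (abs_le_of_sq_le_sq ?_ hq.le)).1
    rw [hqq]
    nlinarith [Real.sin_sq_add_cos_sq (ω * t),
      sq_nonneg (ω * Real.sin (ω * t) + Real.cos (ω * t))]
  have e : A / √(1 + ω ^ 2) = A / (1 + ω ^ 2) * √(1 + ω ^ 2) := by
    nth_rewrite 2 [← hqq]
    field_simp
  rw [e, linearResponse]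
  have := mul_le_mul_of_nonneg_left key (show 0 ≤ A / (1 + ω ^ 2) by positivity)
  linarith

lemma exists_linearResponse_eq {ω : ℝ} (hω : 0 < ω) (A : ℝ) :
    ∃ t, linearResponse ω A t = -(A / √(1 + ω ^ 2)) := by
  have hq : 0 < √(1 + ω ^ 2) := by positivity
  have hqq : √(1 + ω ^ 2) ^ 2 = 1 + ω ^ 2 := Real.sq_sqrt (by positivity)
  -- At this phase `(sin, cos)` is the unit vector opposite to `(1, -ω)`.
  refine ⟨-Real.arctan ω⁻¹ / ω, ?_⟩
  have e : ω * (-Real.arctan ω⁻¹ / ω) = -Real.arctan ω⁻¹ := by field_simp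
  have e2 : √(1 + ω⁻¹ ^ 2) = √(1 + ω ^ 2) / ω := by
    rw [show 1 + ω⁻¹ ^ 2 = (1 + ω ^ 2) / ω ^ 2 by field_simp; ring,
      Real.sqrt_div (by positivity), Real.sqrt_sq hω.le]
  rw [linearResponse, e, Real.sin_neg, Real.cos_neg, Real.sin_arctan, Real.cos_arctan, e2, ← hqq]
  field_simp
  rw [hqq]
  ring

/-! ### Small and large amplitudes -/

namespace IsPeriodicSolution

variable {f : ℝ → ℝ} {ω A : ℝ} {y : ℝ → ℝ}

/-- Comparison of the infimum of a solution with that of the linear response. -/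
lemma periodInf_mem_Icc (hf : IsContactLaw f) (hω : 0 < ω) (hA : 0 ≤ A)
    (hy : IsPeriodicSolution f ω A y) {δ : ℝ} (hδ : ∀ t, f (y t) + y t ≤ δ) :
    periodInf ω y ∈ Icc (-(A / √(1 + ω ^ 2))) (-(A / √(1 + ω ^ 2)) + δ) := by
  have hT : 0 < 2 * Real.pi / ω := by positivity
  have hd : ∀ t, HasDerivAt (fun t => y t - linearResponse ω A t)
      (f (y t) + y t - (y t - linearResponse ω A t)) t := fun t => by
    convert! (hy.hasDerivAt t).sub (hasDerivAt_linearResponse ω A t) using 1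
    ring
  have hp : Function.Periodic (fun t => y t - linearResponse ω A t) (2 * Real.pi / ω) :=
    hy.periodic.sub (linearResponse_periodic hω A)
  obtain ⟨s, -, hs, hmin, -⟩ := hy.exists_eq_periodInf hω
  rw [← hs]
  constructor
  -- At the minimum of the difference, its value is `f y + y ≥ 0`; at the maximum, it is at most
  -- `δ`.
  · obtain ⟨r, -, hr, h0⟩ := hp.exists_forall_ge_deriv_eq_zero hT hd
    have h1 := hr s
    have h2 := hf.neg_le (hy.neg_one_lt r)
    have h3 := neg_div_sqrt_le_linearResponse (ω := ω) hA s
    linarith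
  · obtain ⟨r, -, hr, h0⟩ := hp.exists_forall_le_deriv_eq_zero hT hd
    obtain ⟨q, hq⟩ := exists_linearResponse_eq hω A
    have h1 := hr q
    have h2 := hδ r
    have h3 := hmin q
    linarith

/-- If the amplitude is large, a periodic solution cannot stay above a level `b > -1`. The time
`δ` separates the part of the period where the solution may be below `1`. -/
lemma periodInf_lt (hf : IsContactLaw f) (hω : 0 < ω) (hy : IsPeriodicSolution f ω A y)
    {b δ : ℝ} (hb : -1 < b) (hb0 : b ≤ 0) (hδ : 0 < δ) (hδT : δ < 2 * Real.pi / ω / 2)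
    (hδb : 2 * δ * f b + f 1 * (2 * Real.pi / ω - 2 * δ) < 0) (hA : 0 ≤ A)
    (hAδ : 2 + f b * (2 * Real.pi / ω) ≤ A / ω * (1 - Real.cos (ω * δ))) :
    periodInf ω y < b := by
  set T := 2 * Real.pi / ω with hTdef
  have hT : 0 < T := by positivity
  have hωT : ω * T = 2 * Real.pi := by rw [hTdef]; field_simp
  have hAω : 0 ≤ A / ω := by positivity
  by_contra! hge
  obtain ⟨s, -, hs, hmin, -⟩ := hy.exists_eq_periodInf hω
  have hyb : ∀ t, b ≤ y t := fun t => hge.trans (hs ▸ hmin t)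
  have hfb : 0 ≤ f b := by
    rw [← hf.map_zero]
    exact hf.strictAntiOn.antitoneOn hb (show (-1 : ℝ) < 0 by norm_num) hb0
  have hfy : ∀ t, f (y t) ≤ f b := fun t =>
    hf.strictAntiOn.antitoneOn hb (hy.neg_one_lt t) (hyb t)
  set z : ℝ → ℝ := fun t => y t + A / ω * Real.cos (ω * t) with hz
  have hzd : ∀ t, HasDerivAt z (f (y t)) t := hy.hasDerivAt_add_cos hω
  have hzp : Function.Periodic z T := hy.periodic_add_cos hω
  have hmv : ∀ C t₁ t₂, t₁ ≤ t₂ → (∀ t ∈ Icc t₁ t₂, f (y t) ≤ C) →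
      z t₂ - z t₁ ≤ C * (t₂ - t₁) := fun C t₁ t₂ h hC =>
    (convex_Icc t₁ t₂).image_sub_le_mul_sub_of_deriv_le
      (fun t _ => (hzd t).continuousAt.continuousWithinAt)
      (fun t _ => (hzd t).differentiableAt.differentiableWithinAt)
      (fun t ht => by rw [(hzd t).deriv]; exact hC t (interior_subset ht))
      t₁ ⟨le_rfl, h⟩ t₂ ⟨h, le_rfl⟩ h
  -- Going back from `T`, where `z T = z 0 > A / ω - 1`, the value of `z` drops by at most `f b *
  -- T`.
  have hzlow : ∀ t ∈ Icc 0 T, A / ω - 1 - f b * T ≤ z t := fun t ht => by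
    have h1 := hmv (f b) t T ht.2 fun t _ => hfy t
    have h2 : z T = z 0 := by simpa using hzp 0
    have h3 : z 0 = y 0 + A / ω := by simp [hz]
    nlinarith [hy.neg_one_lt 0, mul_nonneg hfb ht.1]
  have hcos : ∀ t ∈ Icc δ (T - δ), Real.cos (ω * t) ≤ Real.cos (ω * δ) := fun t ht => by
    have hδ0 : 0 ≤ ω * δ := by positivity
    have h1 : ω * δ ≤ ω * t := mul_le_mul_of_nonneg_left ht.1 hω.le
    have h2 : ω * t ≤ 2 * Real.pi - ω * δ := by
      have := mul_le_mul_of_nonneg_left ht.2 hω.le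
      rwa [mul_sub, hωT] at this
    rcases le_total (ω * t) Real.pi with h | h
    · exact Real.cos_le_cos_of_nonneg_of_le_pi hδ0 h h1
    · rw [← Real.cos_two_pi_sub (ω * t)]
      exact Real.cos_le_cos_of_nonneg_of_le_pi hδ0 (by linarith) (by linarith)
  have hone : ∀ t ∈ Icc δ (T - δ), f (y t) ≤ f 1 := fun t ht => by
    refine hf.strictAntiOn.antitoneOn (show (-1 : ℝ) < 1 by norm_num) (hy.neg_one_lt t) ?_
    have h1 := hzlow t ⟨by linarith [ht.1], by linarith [ht.2]⟩
    have h2 := mul_le_mul_of_nonneg_left (hcos t ht) hAω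
    simp only [hz] at h1
    linarith
  -- From `δ` to `δ + T` the increment of `z` is at most the left side of `hδb`, hence negative,
  -- against periodicity.
  have h1 := hmv (f 1) δ (T - δ) (by linarith) hone
  have h2 := hmv (f b) (T - δ) (δ + T) (by linarith) fun t _ => hfy t
  rw [hzp δ] at h2
  linarith

end IsPeriodicSolution

theorem theorem5p7 (f : ℝ → ℝ) (hf : IsContactLaw f) (ω : ℝ) (hω : 0 < ω) :
    ∃ Y : ℝ → ℝ → ℝ,
      -- `Y A` is the unique `T`-periodic solution with forcing amplitude `A`
      (∀ A : ℝ, 0 ≤ A → IsPeriodicSolution f ω A (Y A) ∧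
        ∀ y : ℝ → ℝ, IsPeriodicSolution f ω A y → y = Y A) ∧
      -- the infimum over one period is attained, and satisfies the bounds
      (∀ A : ℝ, 0 ≤ A →
        (∃ t ∈ Icc 0 (2 * Real.pi / ω), Y A t = periodInf ω (Y A)) ∧
        f (contactInv f A) = A ∧ -1 < contactInv f A ∧
        contactInv f A ≤ periodInf ω (Y A) ∧ periodInf ω (Y A) ≤ 0) ∧
      -- behaviour for small and for large amplitudes
      (fun A : ℝ => periodInf ω (Y A) - (-(A / Real.sqrt (1 + ω ^ 2))))
        =O[𝓝[≥] 0] (fun A : ℝ => A ^ 2) ∧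
      Tendsto (fun A : ℝ => periodInf ω (Y A)) atTop (𝓝 (-1)) := by
  -- The sign condition sits inside the existential so that `choose` gives a family over all real
  -- `A`, with `0` as a dummy for `A < 0`.
  have hex : ∀ A : ℝ, ∃ y, 0 ≤ A → IsPeriodicSolution f ω A y := fun A => by
    by_cases hA : 0 ≤ A
    · obtain ⟨y, hy⟩ := hf.exists_isPeriodicSolution hω hA
      exact ⟨y, fun _ => hy⟩
    · exact ⟨0, fun h => absurd h hA⟩
  choose Y hY using hex
  have hinf : ∀ A : ℝ, 0 ≤ A → -1 < periodInf ω (Y A) := fun A hA =>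
    (hf.neg_one_lt_contactInv hA).trans_le ((hY A hA).contactInv_le hf hω hA)
  refine ⟨Y, fun A hA => ⟨hY A hA, fun y hy => hy.unique hf hω (hY A hA)⟩, fun A hA => ?_, ?_, ?_⟩
  · obtain ⟨s, hs, h, -⟩ := (hY A hA).exists_eq_periodInf hω
    exact ⟨⟨s, hs, h⟩, hf.map_contactInv hA, hf.neg_one_lt_contactInv hA,
      (hY A hA).contactInv_le hf hω hA, (hY A hA).periodInf_nonpos hf hω⟩
  · obtain ⟨K, r, hK, hr, hKr⟩ := hf.exists_add_self_le
    set C := 1 + 2 / ω with hC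
    have hC0 : 0 < C := by positivity
    refine IsBigO.of_bound (K * C ^ 2) ?_
    have hsmall : ∀ᶠ A in 𝓝[≥] (0 : ℝ), A < r / C :=
      mem_nhdsWithin_of_mem_nhds (Iio_mem_nhds (by positivity))
    filter_upwards [hsmall, self_mem_nhdsWithin] with A hAr hA
    have hA0 : 0 ≤ A := hA
    rw [lt_div_iff₀ hC0] at hAr
    have hbd : ∀ t, f (Y A t) + Y A t ≤ K * C ^ 2 * A ^ 2 := fun t => by
      have h1 := (hY A hA0).abs_le hf hω hA0 t
      have h2 := sq_le_sq' (by linarith [abs_nonneg (Y A t)]) h1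
      rw [sq_abs] at h2
      calc f (Y A t) + Y A t ≤ K * Y A t ^ 2 := hKr _ (by linarith)
        _ ≤ K * (C * A) ^ 2 := mul_le_mul_of_nonneg_left h2 hK
        _ = K * C ^ 2 * A ^ 2 := by ring
    have := (hY A hA0).periodInf_mem_Icc hf hω hA0 hbd
    rw [Real.norm_eq_abs, Real.norm_eq_abs, abs_of_nonneg (sq_nonneg A),
      abs_of_nonneg (by linarith [this.1])]
    linarith [this.2]
  · refine tendsto_order.2 ⟨fun a ha => ?_, fun a ha => ?_⟩
    · filter_upwards [eventually_ge_atTop 0] with A hA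
      exact ha.trans (hinf A hA)
    · set T := 2 * Real.pi / ω with hT
      have hT0 : 0 < T := by positivity
      set b := min a 0 with hb
      have hb1 : -1 < b := lt_min ha (by norm_num)
      have hb0 : b ≤ 0 := min_le_right _ _
      have hfb : 0 ≤ f b := by linarith [hf.neg_le hb1]
      have hf1 : f 1 < 0 := by
        rw [← hf.map_zero]
        exact hf.strictAntiOn (show (-1 : ℝ) < 0 by norm_num) (show (-1 : ℝ) < 1 by norm_num)
          one_pos
      have hden : 0 < f b - f 1 := by linarith
      -- Half the critical value: it makes `2 * δ * f b + f 1 * (T - 2 * δ)` equal to `f 1 * T / 2 <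
      -- 0`.
      set δ := -f 1 * T / (4 * (f b - f 1)) with hδ
      have hδ0 : 0 < δ := div_pos (mul_pos (by linarith) hT0) (by linarith)
      have hδe : δ * (4 * (f b - f 1)) = -f 1 * T := by rw [hδ]; field_simp
      have hδT : δ < T / 2 := by nlinarith
      have hcos : 0 < 1 - Real.cos (ω * δ) := by
        have h1 : ω * δ < Real.pi := by
          have := mul_lt_mul_of_pos_left hδT hω
          have e : ω * (T / 2) = Real.pi := by rw [hT]; field_simp
          linarith
        have := Real.cos_lt_cos_of_nonneg_of_le_pi le_rfl h1.le (mul_pos hω hδ0)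
        rw [Real.cos_zero] at this
        linarith
      filter_upwards [eventually_ge_atTop 0,
        eventually_ge_atTop ((2 + f b * T) / (1 - Real.cos (ω * δ)) * ω)] with A hA hA'
      refine ((hY A hA).periodInf_lt hf hω hb1 hb0 hδ0 hδT ?_ hA ?_).trans_le (min_le_left _ _)
      · nlinarith
      · rwa [← div_le_iff₀ hcos, le_div_iff₀ hω]
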